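/- Let $a,b\ge 1$ be integers and consider the randomized complete block design (RCBD) mixed model $$y_{ij}=\mu+\alpha_i+\beta_j+e_{ij},\qquad i=1,\dots,a,\ j=1,\dots,b,$$ where $\mu,\alpha_1,\dots,\alpha_a$ are fixed real numbers, $\beta_j\sim N(0,\sigma^2_\beta)$ with $\sigma^2_\beta\ge 0$, $e_{ij}\sim N(0,\sigma^2)$ with $\sigma^2>0$, and all the variables $\beta_j$ and $e_{ij}$ are mutually independent. Let $\bar y_{i.}$, $\bar y_{.j}$, $\bar y_{..}$ be the means of the $y_{ij}$ over $j$, over $i$, and over both, let $\bar\alpha=\frac1a\sum_i\alpha_i$, and put $$SS_A=b\sum_{i=1}^a(\bar y_{i.}-\bar y_{..})^2,\quad SS_B=a\sum_{j=1}^b(\bar y_{.j}-\bar y_{..})^2,\quad SS_E=\sum_{i=1}^a\sum_{j=1}^b(y_{ij}-\bar y_{i.}-\bar y_{.j}+\bar y_{..})^2,\quad \gamma_A=b\sum_{i=1}^a(\alpha_i-\bar\alpha)^2 .$$ Here $\chi^2(p,\lambda)$ is the noncentral chi-square distribution, i.e. the law of $\sum_{i=1}^pX_i^2$ for independent $X_i\sim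 N(\delta_i,1)$ with $\sum_i\delta_i^2=\lambda$; $\chi^2(p)=\chi^2(p,0)$, and $\chi^2(0)$ is the point mass at $0$. $F(m,n,\lambda)$ is the law of $(U/m)/(V/n)$ with $U\sim\chi^2(m,\lambda)$ and $V\sim\chi^2(n)$ independent; $F(m,n)=F(m,n,0)$. Then $SS_A$, $SS_B$ and $SS_E$ are mutually independent, and $$SS_A\sim\sigma^2\chi^2(a-1,\gamma_A/\sigma^2),\qquad SS_B\sim(\sigma^2+a\sigma^2_\beta)\,\chi^2(b-1),\qquad SS_E\sim\sigma^2\chi^2((a-1)(b-1)).$$ If moreover $a,b\ge2$, then with $MS_A=SS_A/(a-1)$, $MS_B=SS_B/(b-1)$ and $MS_E=SS_E/[(a-1)(b-1)]$, $$F_A=\frac{MS_A}{MS_E}\sim F\bigl(a-1,(a-1)(b-1),\gamma_A/\sigma^2\bigr),\qquad F_B=\frac{MS_B}{MS_E}\sim\frac{\sigma^2+a\sigma^2_\beta}{\sigma^2}\,F\bigl(b-1,(a-1)(b-1)\bigr).$$ In particular, $F_A\sim F(a-1,(a-1)(b-1))$ if $\gamma_A=0$, and $F_B\sim F(b-1,(a-1)(b-1))$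 if $\sigma^2_\beta=0$. -/

import Mathlib

open MeasureTheory ProbabilityTheory
open scoped NNReal

namespace RCBD

noncomputable section

/-- The noncentral chi-square distribution `χ²(p, lam)` (with `lam ≥ 0`): the law of
`X₁² + ⋯ + X_p²` for independent `Xᵢ ~ N(δᵢ, 1)` with `∑ δᵢ² = lam`. This law depends on the mean
vector `δ` only through `lam`; the representative `δ = (√lam, 0, …, 0)` is used. -/
def noncentralChiSquare (p : ℕ) (lam : ℝ) : Measure ℝ :=
  (Measure.pi fun i : Fin p => gaussianReal (if (i : ℕ) = 0 then √lam else 0) 1).map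
    fun x => ∑ i, x i ^ 2

/-- The central chi-square distribution `χ²(p)`: the law of a sum of squares of `p` independent
standard normal variables. -/
def chiSquare (p : ℕ) : Measure ℝ :=
  (Measure.pi fun _ : Fin p => gaussianReal 0 1).map fun x => ∑ i, x i ^ 2

/-- The noncentral F distribution `F(m, n, lam)`: the law of `(U / m) / (V / n)` for independent
`U ~ χ²(m, lam)` and `V ~ χ²(n)`. -/
def noncentralF (m n : ℕ) (lam : ℝ) : Measure ℝ :=
  ((noncentralChiSquare m lam).prod (chiSquare n)).map fun q => (q.1 / m) / (q.2 / n)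

/-- The central F distribution `F(m, n)`. -/
def centralF (m n : ℕ) : Measure ℝ :=
  ((chiSquare m).prod (chiSquare n)).map fun q => (q.1 / m) / (q.2 / n)

/-- The law of `c * X` when `X` has law `ν`. -/
def scaled (c : ℝ) (ν : Measure ℝ) : Measure ℝ := ν.map fun x => c * x

variable {a b : ℕ}

/-- The mean of a finite family. -/
def mean {n : ℕ} (x : Fin n → ℝ) : ℝ := (∑ i, x i) / n

/-- The mean `ȳ_{i.}` of the observations at level `i` of factor A. -/
def rowMean (y : Fin a → Fin b → ℝ) (i : Fin a) : ℝ := (∑ j, y i j) / b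

/-- The mean `ȳ_{.j}` of the observations in block `j`. -/
def colMean (y : Fin a → Fin b → ℝ) (j : Fin b) : ℝ := (∑ i, y i j) / a

/-- The overall mean `ȳ_{..}`. -/
def grandMean (y : Fin a → Fin b → ℝ) : ℝ := (∑ i, ∑ j, y i j) / (a * b)

/-- The sum of squares due to factor A. -/
def SSA (y : Fin a → Fin b → ℝ) : ℝ := b * ∑ i, (rowMean y i - grandMean y) ^ 2

/-- The sum of squares due to the block factor B. -/
def SSB (y : Fin a → Fin b → ℝ) : ℝ := a * ∑ j, (colMean y j - grandMean y) ^ 2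

/-- The error sum of squares. -/
def SSE (y : Fin a → Fin b → ℝ) : ℝ :=
  ∑ i, ∑ j, (y i j - rowMean y i - colMean y j + grandMean y) ^ 2

/-- The mean squares. -/
def MSA (y : Fin a → Fin b → ℝ) : ℝ := SSA y / ((a : ℝ) - 1)

def MSB (y : Fin a → Fin b → ℝ) : ℝ := SSB y / ((b : ℝ) - 1)

def MSE (y : Fin a → Fin b → ℝ) : ℝ := SSE y / (((a : ℝ) - 1) * ((b : ℝ) - 1))

/-- The test statistics. -/
def FA (y : Fin a → Fin b → ℝ) : ℝ := MSA y / MSE y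

def FB (y : Fin a → Fin b → ℝ) : ℝ := MSB y / MSE y

/-- `γ_A = b ∑ᵢ (αᵢ - ᾱ)²`, where `b` is the number of blocks. -/
def gammaA (b : ℕ) (α : Fin a → ℝ) : ℝ := b * ∑ i, (α i - mean α) ^ 2

end

end RCBD

/-!
Let `U` and `V` be orthogonal matrices that rotate the all-ones vectors of `ℝᵃ` and `ℝᵇ` onto the
first coordinate axis. The covariance matrix of the observations is `σ_β² (J ⊗ I) + σ² I`, with `J`
the all-ones matrix, so in the coordinates `(U ⊗ V) y` it is diagonal: these coordinates are
independent normal variables of variance `σ² + a σ_β²` at `(0, l)` and `σ²` elsewhere. The three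
sums of squares are the sums of the squared coordinates over the disjoint index sets `k ≠ 0 = l`,
`k = 0 ≠ l` and `k ≠ 0 ≠ l`. This gives independence and the chi-square laws, and the same formula
applied to the table of the means evaluates the noncentrality parameters.
-/

namespace RCBD

open Matrix
open scoped Kronecker

section Orthogonal

variable {ι : Type*} [Fintype ι] [DecidableEq ι]

lemma sum_sq_mulVec_of_mem_orthogonalGroup {Q : Matrix ι ι ℝ} (hQ : Q ∈ orthogonalGroup ι ℝ)
    (x : ι → ℝ) : ∑ k, (Q *ᵥ x) k ^ 2 = ∑ i, x i ^ 2 := by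
  simp only [pow_two]
  change Q *ᵥ x ⬝ᵥ Q *ᵥ x = x ⬝ᵥ x
  rw [dotProduct_mulVec, vecMul_mulVec, (mem_orthogonalGroup_iff' ι ℝ).1 hQ, vecMul_one]

lemma exists_mem_orthogonalGroup_mulVec_eq_single (i₀ : ι) (x : ι → ℝ) :
    ∃ Q ∈ orthogonalGroup ι ℝ, Q *ᵥ x = Pi.single i₀ √(∑ i, x i ^ 2) := by
  obtain rfl | hx := eq_or_ne x 0
  · exact ⟨1, one_mem _, by simp⟩
  set v : EuclideanSpace ℝ ι := WithLp.toLp 2 x with hv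
  have hv0 : v ≠ 0 := by simpa [hv] using hx
  have hunit : Orthonormal ℝ (({i₀} : Set ι).domRestrict fun _ => ‖v‖⁻¹ • v) :=
    ⟨fun _ => by simpa using norm_smul_inv_norm (𝕜 := ℝ) hv0,
      fun i j hij => (hij (Subsingleton.elim i j)).elim⟩
  obtain ⟨B, hB⟩ := hunit.exists_orthonormalBasis_extension_of_card_eq (by simp)
  have hdir : v = ‖v‖ • B i₀ := by
    rw [hB i₀ rfl, smul_inv_smul₀ (norm_ne_zero_iff.2 hv0)]
  have hinner (k l : ι) : ∑ i, B k i * B l i = if k = l then 1 else 0 := by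
    simpa [PiLp.inner_apply, mul_comm] using orthonormal_iff_ite.1 B.orthonormal k l
  refine ⟨of fun k i => B k i, (mem_orthogonalGroup_iff ι ℝ).2 ?_, funext fun k => ?_⟩
  · ext k l
    simpa [mul_apply, one_apply] using hinner k l
  · have hcoord (i : ι) : x i = ‖v‖ * B i₀ i := by simpa [hv] using congr($hdir i)
    have hnorm : √(∑ i, x i ^ 2) = ‖v‖ := by simp [EuclideanSpace.norm_eq, hv]
    calc ∑ i, B k i * x i = ‖v‖ * ∑ i, B k i * B i₀ i := by
          simp only [hcoord, Finset.mul_sum, mul_left_comm]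
      _ = _ := by simp [hinner, hnorm, Pi.single_apply]

end Orthogonal

section Helmert

variable {n : ℕ} [NeZero n] {U : Matrix (Fin n) (Fin n) ℝ}

/-- A Helmert matrix: an orthogonal matrix that rotates the all-ones vector onto the `0`-th
coordinate axis, so that its `0`-th row is constant and its other rows are orthonormal contrasts.
Coordinate `0` of `U *ᵥ x` carries the mean of `x`, the other ones the deviations from it. -/
structure IsHelmert (U : Matrix (Fin n) (Fin n) ℝ) : Prop where
  mem_orthogonalGroup : U ∈ orthogonalGroup (Fin n) ℝ
  mulVec_one : U *ᵥ 1 = Pi.single 0 √n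

variable (n) in
lemma exists_isHelmert : ∃ U : Matrix (Fin n) (Fin n) ℝ, IsHelmert U := by
  obtain ⟨U, hU, hU1⟩ := exists_mem_orthogonalGroup_mulVec_eq_single (0 : Fin n) 1
  exact ⟨U, hU, by simpa using hU1⟩

namespace IsHelmert

lemma mulVec_apply_zero (hU : IsHelmert U) (x : Fin n → ℝ) : (U *ᵥ x) 0 = √n * mean x := by
  have hsum : √n * (U *ᵥ x) 0 = ∑ i, x i := by
    calc √n * (U *ᵥ x) 0 = U *ᵥ 1 ⬝ᵥ U *ᵥ x := by rw [hU.mulVec_one, single_dotProduct]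
      _ = 1 ⬝ᵥ x := by
        rw [dotProduct_mulVec, vecMul_mulVec,
          (mem_orthogonalGroup_iff' (Fin n) ℝ).1 hU.mem_orthogonalGroup, vecMul_one]
      _ = ∑ i, x i := one_dotProduct x
  have hn : (0 : ℝ) < n := Nat.cast_pos.2 (Nat.pos_of_neZero n)
  rw [mean, ← hsum, ← mul_div_assoc, ← mul_assoc, Real.mul_self_sqrt hn.le,
    mul_div_cancel_left₀ _ hn.ne']

lemma sum_sq_mulVec_compl (hU : IsHelmert U) (x : Fin n → ℝ) :
    ∑ k ∈ {0}ᶜ, (U *ᵥ x) k ^ 2 = ∑ i, (x i - mean x) ^ 2 := by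
  have hn : (n : ℝ) ≠ 0 := NeZero.ne _
  have hx : ∑ i, x i = n * mean x := by rw [mean, mul_div_cancel₀ _ hn]
  have htotal := Fintype.sum_eq_add_sum_compl 0 fun k => (U *ᵥ x) k ^ 2
  rw [sum_sq_mulVec_of_mem_orthogonalGroup hU.mem_orthogonalGroup, hU.mulVec_apply_zero, mul_pow,
    Real.sq_sqrt n.cast_nonneg] at htotal
  calc ∑ k ∈ {0}ᶜ, (U *ᵥ x) k ^ 2 = ∑ i, x i ^ 2 - n * mean x ^ 2 := by linarith
    _ = ∑ i, (x i - mean x) ^ 2 := by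
      simp only [sub_sq, Finset.sum_add_distrib, Finset.sum_sub_distrib, ← Finset.sum_mul,
        ← Finset.mul_sum, hx, Finset.sum_const, Finset.card_univ, Fintype.card_fin, nsmul_eq_mul]
      ring

end IsHelmert

end Helmert

section SumsOfSquares

variable {a b : ℕ}

lemma mean_rowMean (y : Fin a → Fin b → ℝ) : mean (rowMean y) = grandMean y := by
  simp only [mean, rowMean, grandMean, ← Finset.sum_div, div_div, mul_comm]

lemma mean_colMean (y : Fin a → Fin b → ℝ) : mean (colMean y) = grandMean y := by
  simp only [mean, colMean, grandMean, ← Finset.sum_div, div_div]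
  rw [Finset.sum_comm]

lemma mean_sub (x z : Fin a → ℝ) : mean (x - z) = mean x - mean z := by
  simp [mean, Finset.sum_sub_distrib, sub_div]

lemma kronecker_mulVec_uncurry (U : Matrix (Fin a) (Fin a) ℝ) (V : Matrix (Fin b) (Fin b) ℝ)
    (y : Fin a → Fin b → ℝ) (k : Fin a) (l : Fin b) :
    ((U ⊗ₖ V) *ᵥ Function.uncurry y) (k, l) = (U *ᵥ fun i => (V *ᵥ y i) l) k := by
  simp only [mulVec, dotProduct, kroneckerMap_apply, Fintype.sum_prod_type, Finset.mul_sum,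
    Function.uncurry_apply_pair, mul_assoc]

lemma mulVec_mulVec_swap (U : Matrix (Fin a) (Fin a) ℝ) (V : Matrix (Fin b) (Fin b) ℝ)
    (y : Fin a → Fin b → ℝ) (k : Fin a) (l : Fin b) :
    (U *ᵥ fun i => (V *ᵥ y i) l) k = (V *ᵥ fun j => (U *ᵥ fun i => y i j) k) l := by
  simp only [mulVec, dotProduct, Finset.mul_sum]
  rw [Finset.sum_comm]
  simp only [mul_left_comm]

variable [NeZero a] [NeZero b] {U : Matrix (Fin a) (Fin a) ℝ} {V : Matrix (Fin b) (Fin b) ℝ}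

variable (a b) in
/-- The coordinates of `(U ⊗ₖ V) *ᵥ y`, for Helmert matrices `U` and `V`, that make up the treatment
(`0`), the block (`1`) and the error (`2`) sum of squares. The remaining coordinate `(0, 0)` carries
the grand mean. -/
def stratum : Fin 3 → Finset (Fin a × Fin b) :=
  ![{0}ᶜ ×ˢ {0}, {0} ×ˢ {0}ᶜ, {0}ᶜ ×ˢ {0}ᶜ]

lemma pairwise_disjoint_stratum : Pairwise (Function.onFun Disjoint (stratum a b)) := by
  intro c c' hc
  rw [Function.onFun]
  fin_cases c <;> fin_cases c' <;> simp_all [stratum, Finset.disjoint_product,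
    -Finset.product_singleton, -Finset.singleton_product]

lemma card_stratum_zero : (stratum a b 0).card = a - 1 := by simp [stratum, Finset.card_compl]

lemma card_stratum_one : (stratum a b 1).card = b - 1 := by simp [stratum, Finset.card_compl]

lemma card_stratum_two : (stratum a b 2).card = (a - 1) * (b - 1) := by
  simp [stratum, Finset.card_compl]

lemma sum_stratum_zero_sq_eq_SSA (hU : IsHelmert U) (hV : IsHelmert V) (y : Fin a → Fin b → ℝ) :
    ∑ t ∈ stratum a b 0, ((U ⊗ₖ V) *ᵥ Function.uncurry y) t ^ 2 = SSA y := by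
  have hcoord (k : Fin a) :
      ((U ⊗ₖ V) *ᵥ Function.uncurry y) (k, 0) = √b * (U *ᵥ rowMean y) k := by
    simp only [kronecker_mulVec_uncurry, hV.mulVec_apply_zero]
    exact congrFun (mulVec_smul U √b (rowMean y)) k
  simp only [stratum, cons_val_zero, Finset.sum_product, Finset.sum_singleton, hcoord, mul_pow,
    Real.sq_sqrt b.cast_nonneg, ← Finset.mul_sum, hU.sum_sq_mulVec_compl, mean_rowMean, SSA]

lemma sum_stratum_one_sq_eq_SSB (hU : IsHelmert U) (hV : IsHelmert V) (y : Fin a → Fin b → ℝ) :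
    ∑ t ∈ stratum a b 1, ((U ⊗ₖ V) *ᵥ Function.uncurry y) t ^ 2 = SSB y := by
  have hcoord (l : Fin b) :
      ((U ⊗ₖ V) *ᵥ Function.uncurry y) (0, l) = √a * (V *ᵥ colMean y) l := by
    simp only [kronecker_mulVec_uncurry, mulVec_mulVec_swap U, hU.mulVec_apply_zero]
    exact congrFun (mulVec_smul V √a (colMean y)) l
  simp only [stratum, cons_val_one, cons_val_zero, Finset.sum_product, Finset.sum_singleton, hcoord,
    mul_pow, Real.sq_sqrt a.cast_nonneg, ← Finset.mul_sum, hV.sum_sq_mulVec_compl, mean_colMean,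
    SSB]

lemma sum_stratum_two_sq_eq_SSE (hU : IsHelmert U) (hV : IsHelmert V) (y : Fin a → Fin b → ℝ) :
    ∑ t ∈ stratum a b 2, ((U ⊗ₖ V) *ᵥ Function.uncurry y) t ^ 2 = SSE y := by
  have hcol (i : Fin a) (l : Fin b) :
      (V *ᵥ y i) l - mean (fun i => (V *ᵥ y i) l) = (V *ᵥ (y i - colMean y)) l := by
    have hmean : mean (fun i => (V *ᵥ y i) l) = (V *ᵥ colMean y) l := by
      simp only [mean, colMean, mulVec, dotProduct, mul_div_assoc', Finset.mul_sum,
        ← Finset.sum_div]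
      rw [Finset.sum_comm]
    rw [hmean, mulVec_sub, Pi.sub_apply]
  have hrow (i : Fin a) (j : Fin b) : (y i - colMean y) j - mean (y i - colMean y)
      = y i j - rowMean y i - colMean y j + grandMean y := by
    rw [mean_sub, mean_colMean, Pi.sub_apply]
    change _ - (rowMean y i - _) = _
    ring
  calc ∑ t ∈ stratum a b 2, ((U ⊗ₖ V) *ᵥ Function.uncurry y) t ^ 2
      = ∑ l ∈ {0}ᶜ, ∑ k ∈ {0}ᶜ, (U *ᵥ fun i => (V *ᵥ y i) l) k ^ 2 := by
        simp only [stratum, cons_val, Finset.sum_product_right, kronecker_mulVec_uncurry]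
    _ = ∑ i, ∑ l ∈ {0}ᶜ, (V *ᵥ (y i - colMean y)) l ^ 2 := by
        simp only [hU.sum_sq_mulVec_compl, hcol]
        exact Finset.sum_comm
    _ = SSE y := by simp only [hV.sum_sq_mulVec_compl, hrow, SSE]

end SumsOfSquares

section GaussianVector

variable {Ω S T : Type*} [MeasurableSpace Ω] {P : Measure Ω}

/-- The random vector `Y` has the multivariate normal distribution with mean vector `m` and
covariance matrix `K`. It is described by its first two moments, not by an equality of laws with
`multivariateGaussian`, so that `S → ℝ` need not be replaced by `EuclideanSpace ℝ S`. -/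
structure IsGaussianVector (Y : Ω → S → ℝ) (m : S → ℝ) (K : Matrix S S ℝ) (P : Measure Ω) :
    Prop where
  hasGaussianLaw : HasGaussianLaw Y P
  integral_eval (s : S) : P[fun ω => Y ω s] = m s
  covariance_eval (s t : S) : cov[fun ω => Y ω s, fun ω => Y ω t; P] = K s t

lemma isGaussianVector_of_iIndepFun [Finite S] [DecidableEq S] {X : S → Ω → ℝ} {m : S → ℝ}
    {v : S → ℝ≥0} (hX : ∀ s, HasLaw (X s) (gaussianReal (m s) (v s)) P) (hind : iIndepFun X P) :
    IsGaussianVector (fun ω s => X s ω) m (diagonal fun s => (v s : ℝ)) P where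
  hasGaussianLaw :=
    have := Fintype.ofFinite S
    hind.hasGaussianLaw fun s => (hX s).hasGaussianLaw
  integral_eval s := by rw [(hX s).integral_eq, integral_id_gaussianReal]
  covariance_eval s t := by
    have := hind.isProbabilityMeasure
    obtain rfl | hst := eq_or_ne s t
    · rw [covariance_self (hX s).aemeasurable, (hX s).variance_eq, variance_id_gaussianReal,
        diagonal_apply_eq]
    · rw [(hind.indepFun hst).covariance_eq_zero (hX s).hasGaussianLaw.memLp_two
        (hX t).hasGaussianLaw.memLp_two, diagonal_apply_ne _ hst]

namespace IsGaussianVector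

variable {Y : Ω → S → ℝ} {m : S → ℝ} {K : Matrix S S ℝ}

lemma memLp_two_eval (hY : IsGaussianVector Y m K P) (s : S) : MemLp (fun ω => Y ω s) 2 P :=
  (hY.hasGaussianLaw.eval s).memLp_two

protected lemma mulVec [Fintype S] [Finite T] (hY : IsGaussianVector Y m K P)
    (M : Matrix T S ℝ) : IsGaussianVector (fun ω => M *ᵥ Y ω) (M *ᵥ m) (M * K * Mᵀ) P where
  hasGaussianLaw :=
    have := Fintype.ofFinite T
    hY.hasGaussianLaw.map_fun M.mulVecLin.toContinuousLinearMap
  integral_eval t := by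
    simp only [mulVec, dotProduct]
    rw [integral_finsetSum _ fun s _ => (hY.hasGaussianLaw.eval s).integrable.const_mul _]
    simp only [integral_const_mul, hY.integral_eval]
  covariance_eval t t' := by
    have := hY.hasGaussianLaw.isProbabilityMeasure
    simp only [mulVec, dotProduct]
    rw [covariance_fun_sum_fun_sum (fun s => (hY.memLp_two_eval s).const_mul _)
      (fun s => (hY.memLp_two_eval s).const_mul _), Finset.sum_comm]
    simp only [covariance_const_mul_left, covariance_const_mul_right, hY.covariance_eval, mul_apply,
      transpose_apply, Finset.sum_mul]
    exact Finset.sum_congr rfl fun s _ => Finset.sum_congr rfl fun s' _ => by ring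

lemma hasLaw_eval (hY : IsGaussianVector Y m K P) {s : S} {v : ℝ≥0} (hv : K s s = v) :
    HasLaw (fun ω => Y ω s) (gaussianReal (m s) v) P where
  aemeasurable := (hY.hasGaussianLaw.eval s).aemeasurable
  map_eq := by
    rw [(hY.hasGaussianLaw.eval s).map_eq_gaussianReal, hY.integral_eval,
      ← covariance_self (hY.hasGaussianLaw.eval s).aemeasurable, hY.covariance_eval, hv,
      Real.toNNReal_coe]

lemma iIndepFun_eval [Finite S] (hY : IsGaussianVector Y m K P) (hK : K.IsDiag) :
    iIndepFun (fun s ω => Y ω s) P :=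
  have := Fintype.ofFinite S
  hY.hasGaussianLaw.iIndepFun_of_covariance_eq_zero fun s t hst =>
    (hY.covariance_eval s t).trans (hK hst)

lemma iIndepFun_restrict [Finite S] (hY : IsGaussianVector Y m K P) (hK : K.IsDiag)
    {κ : Type*} [Finite κ] {A : κ → Finset S} (hA : Pairwise (Function.onFun Disjoint A)) :
    iIndepFun (fun c ω (s : A c) => Y ω s) P := by
  have := Fintype.ofFinite S
  have := Fintype.ofFinite κ
  refine HasGaussianLaw.iIndepFun_of_covariance_eval ?_ fun c c' hc s t => ?_
  · exact hY.hasGaussianLaw.map_fun (ContinuousLinearMap.pi fun c => ContinuousLinearMap.pi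
      fun s : A c => (ContinuousLinearMap.proj (s : S) : (S → ℝ) →L[ℝ] ℝ))
  · have hst : (s : S) ≠ t := fun h => Finset.disjoint_left.1 (hA hc) s.2 (h ▸ t.2)
    exact (hY.covariance_eval s t).trans (hK hst)

end IsGaussianVector

end GaussianVector

section ChiSquare

variable {Ω : Type*} [MeasurableSpace Ω] {P : Measure Ω}

instance isProbabilityMeasure_noncentralChiSquare (p : ℕ) (lam : ℝ) :
    IsProbabilityMeasure (noncentralChiSquare p lam) :=
  Measure.isProbabilityMeasure_map (Measurable.aemeasurable (by fun_prop))

instance isProbabilityMeasure_chiSquare (p : ℕ) : IsProbabilityMeasure (chiSquare p) :=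
  Measure.isProbabilityMeasure_map (Measurable.aemeasurable (by fun_prop))

lemma noncentralChiSquare_zero (p : ℕ) : noncentralChiSquare p 0 = chiSquare p := by
  simp only [noncentralChiSquare, chiSquare, Real.sqrt_zero, ite_self]

lemma noncentralF_zero (p q : ℕ) : noncentralF p q 0 = centralF p q := by
  rw [noncentralF, centralF, noncentralChiSquare_zero]

lemma scaled_one (ν : Measure ℝ) : scaled 1 ν = ν := by
  simp only [scaled, one_mul, Measure.map_id']

lemma hasLaw_const_mul_scaled {X : Ω → ℝ} {ν : Measure ℝ} (hX : HasLaw X ν P) (c : ℝ) :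
    HasLaw (fun ω => c * X ω) (scaled c ν) P :=
  HasLaw.fun_comp ⟨by fun_prop, rfl⟩ hX

lemma exists_mem_orthogonalGroup_mulVec_eq_ite {p : ℕ} (δ : Fin p → ℝ) :
    ∃ Q ∈ orthogonalGroup (Fin p) ℝ,
      Q *ᵥ δ = fun i : Fin p => if (i : ℕ) = 0 then √(∑ i, δ i ^ 2) else 0 := by
  obtain rfl | hp := eq_or_ne p 0
  · exact ⟨1, one_mem _, Subsingleton.elim _ _⟩
  · have : NeZero p := ⟨hp⟩
    obtain ⟨Q, hQ, hQδ⟩ := exists_mem_orthogonalGroup_mulVec_eq_single (0 : Fin p) δ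
    refine ⟨Q, hQ, hQδ.trans (funext fun i => ?_)⟩
    simp only [Pi.single_apply, Fin.ext_iff, Fin.val_zero]

lemma hasLaw_sum_sq_noncentralChiSquare {p : ℕ} {X : Fin p → Ω → ℝ} {δ : Fin p → ℝ}
    (hX : ∀ i, HasLaw (X i) (gaussianReal (δ i) 1) P) (hind : iIndepFun X P) :
    HasLaw (fun ω => ∑ i, X i ω ^ 2) (noncentralChiSquare p (∑ i, δ i ^ 2)) P := by
  obtain ⟨Q, hQ, hQδ⟩ := exists_mem_orthogonalGroup_mulVec_eq_ite δ
  have hrot := (isGaussianVector_of_iIndepFun hX hind).mulVec Q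
  have hcov : Q * (diagonal fun _ => ((1 : ℝ≥0) : ℝ)) * Qᵀ = 1 := by
    rw [NNReal.coe_one, diagonal_one, mul_one]
    exact (mem_orthogonalGroup_iff (Fin p) ℝ).1 hQ
  rw [hcov, hQδ] at hrot
  have hpi := (hrot.iIndepFun_eval isDiag_one).hasLaw_pi fun i =>
    hrot.hasLaw_eval (v := 1) (one_apply_eq i)
  have hsum : HasLaw (fun ω => ∑ i, (Q *ᵥ fun i => X i ω) i ^ 2)
      (noncentralChiSquare p (∑ i, δ i ^ 2)) P :=
    HasLaw.fun_comp (Y := fun x : Fin p → ℝ => ∑ i, x i ^ 2)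
      ⟨Measurable.aemeasurable (by fun_prop), rfl⟩ hpi
  simpa only [sum_sq_mulVec_of_mem_orthogonalGroup hQ] using hsum

lemma hasLaw_div_sqrt_gaussianReal {X : Ω → ℝ} {m : ℝ} {v : ℝ≥0} (hv : 0 < v)
    (hX : HasLaw X (gaussianReal m v) P) :
    HasLaw (fun ω => X ω / √v) (gaussianReal (m / √v) 1) P := by
  convert gaussianReal_div_const hX √v using 2
  rw [eq_comm, div_eq_one_iff_eq]
  · ext; simp
  · rw [← NNReal.coe_ne_zero]
    simp [hv.ne']

lemma hasLaw_sum_sq_scaled_noncentralChiSquare {T : Type*} [Fintype T] {Z : T → Ω → ℝ} {m : T → ℝ}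
    {v : ℝ≥0} (hv : 0 < v) (hZ : ∀ t, HasLaw (Z t) (gaussianReal (m t) v) P)
    (hind : iIndepFun Z P) :
    HasLaw (fun ω => ∑ t, Z t ω ^ 2)
      (scaled v (noncentralChiSquare (Fintype.card T) ((∑ t, m t ^ 2) / v))) P := by
  have hsq (x : T → ℝ) : ∑ i, (x ((Fintype.equivFin T).symm i) / √v) ^ 2 = (∑ t, x t ^ 2) / v := by
    rw [(Fintype.equivFin T).symm.sum_comp fun t => (x t / √v) ^ 2]
    simp only [div_pow, Real.sq_sqrt v.coe_nonneg, Finset.sum_div]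
  have hstd := hasLaw_sum_sq_noncentralChiSquare
    (fun i => hasLaw_div_sqrt_gaussianReal hv (hZ ((Fintype.equivFin T).symm i)))
    ((hind.precomp (Fintype.equivFin T).symm.injective).comp (fun _ x => x / √v)
      fun _ => by fun_prop)
  simp only [hsq] at hstd
  have hscaled := hasLaw_const_mul_scaled hstd v
  simpa only [fun ω => hsq fun t => Z t ω, mul_div_cancel₀ _ (NNReal.coe_ne_zero.2 hv.ne')]
    using hscaled

namespace IsGaussianVector

variable {S : Type*} [Finite S] {Y : Ω → S → ℝ} {m : S → ℝ} {K : Matrix S S ℝ}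

lemma hasLaw_sum_sq (hY : IsGaussianVector Y m K P) (hK : K.IsDiag) {A : Finset S} {v : ℝ≥0}
    (hv : 0 < v) (hA : ∀ s ∈ A, K s s = v) :
    HasLaw (fun ω => ∑ s ∈ A, Y ω s ^ 2)
      (scaled v (noncentralChiSquare A.card ((∑ s ∈ A, m s ^ 2) / v))) P := by
  have h := hasLaw_sum_sq_scaled_noncentralChiSquare hv
    (fun s : A => hY.hasLaw_eval (hA s s.2))
    ((hY.iIndepFun_eval hK).precomp Subtype.val_injective)
  simpa only [Fintype.card_coe, Finset.sum_coe_sort A fun s => m s ^ 2,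
    fun ω => Finset.sum_coe_sort A fun s => Y ω s ^ 2] using h

lemma iIndepFun_sum_sq (hY : IsGaussianVector Y m K P) (hK : K.IsDiag) {κ : Type*} [Finite κ]
    {A : κ → Finset S} (hA : Pairwise (Function.onFun Disjoint A)) :
    iIndepFun (fun c ω => ∑ s ∈ A c, Y ω s ^ 2) P := by
  have h := (hY.iIndepFun_restrict hK hA).comp (fun c x => ∑ s : A c, x s ^ 2)
    fun c => by fun_prop
  simpa only [Function.comp_def, fun c ω => Finset.sum_coe_sort (A c) fun s => Y ω s ^ 2] using h

end IsGaussianVector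

lemma hasLaw_div_div_scaled_noncentralF [IsFiniteMeasure P] {X Y : Ω → ℝ} {p q : ℕ} {lam c d : ℝ}
    (hX : HasLaw X (scaled c (noncentralChiSquare p lam)) P)
    (hY : HasLaw Y (scaled d (chiSquare q)) P) (hXY : IndepFun X Y P) :
    HasLaw (fun ω => (X ω / p) / (Y ω / q)) (scaled (c / d) (noncentralF p q lam)) P := by
  have hprod := hXY.hasLaw_prod hX hY
  rw [scaled, scaled, Measure.map_prod_map _ _ (by fun_prop) (by fun_prop)] at hprod
  refine HasLaw.fun_comp (Y := fun z : ℝ × ℝ => (z.1 / p) / (z.2 / q)) ⟨?_, ?_⟩ hprod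
  · exact Measurable.aemeasurable (by fun_prop)
  · rw [noncentralF, scaled, Measure.map_map (by fun_prop) (by fun_prop),
      Measure.map_map (by fun_prop) (by fun_prop)]
    congr 1
    ext z
    simp only [Function.comp_apply, Prod.map_fst, Prod.map_snd, div_eq_mul_inv, mul_inv]
    ring

end ChiSquare

section BlockDesign

variable {Ω : Type*} [MeasurableSpace Ω] {P : Measure Ω} {a b : ℕ} {σsq σβsq : ℝ≥0}
  {θ : Fin a → Fin b → ℝ} {y : Ω → Fin a → Fin b → ℝ}

/-- The covariance matrix of the observations in a randomized complete block design: two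
observations share the variance `σβsq` of the block effect when they lie in the same block. -/
def blockCov (a b : ℕ) (σsq σβsq : ℝ≥0) : Matrix (Fin a × Fin b) (Fin a × Fin b) ℝ :=
  (σβsq : ℝ) • (vecMulVec 1 1 ⊗ₖ 1) + (σsq : ℝ) • 1

variable (a b) in
/-- The design matrix of the random effects: it maps the vector of the block effects and the errors
to the table of their contributions to the observations. -/
def randomDesign : Matrix (Fin a × Fin b) (Fin b ⊕ Fin a × Fin b) ℝ :=
  fromCols ((1 : Matrix (Fin b) (Fin b) ℝ).submatrix Prod.snd id) 1

lemma randomDesign_mulVec_apply (x : Fin b ⊕ Fin a × Fin b → ℝ) (t : Fin a × Fin b) :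
    (randomDesign a b *ᵥ x) t = x (.inl t.2) + x (.inr t) := by
  simp [randomDesign, mulVec, dotProduct, one_apply]

variable (a b σsq σβsq) in
lemma randomDesign_mul_diagonal_mul_transpose :
    randomDesign a b *
        (diagonal (Sum.elim (fun _ => σβsq) fun _ => σsq) : Matrix (Fin b ⊕ Fin a × Fin b) _ ℝ) *
        (randomDesign a b)ᵀ = blockCov a b σsq σβsq := by
  let B : Matrix (Fin a × Fin b) (Fin b) ℝ := (1 : Matrix (Fin b) (Fin b) ℝ).submatrix Prod.snd id
  have hB : B * Bᵀ = vecMulVec 1 1 ⊗ₖ 1 := by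
    ext t t'
    simp [B, mul_apply, one_apply]
  change fromCols B 1 * _ * (fromCols B 1)ᵀ = _
  rw [← fromBlocks_diagonal, fromCols_mul_fromBlocks, transpose_fromCols, fromCols_mul_fromRows]
  simp only [← smul_one_eq_diagonal, Matrix.mul_zero, Matrix.mul_smul,
    Matrix.smul_mul, Matrix.mul_one, transpose_one, add_zero, zero_add, hB, blockCov]

lemma isGaussianVector_of_block_model {β : Fin b → Ω → ℝ} {e : Fin a → Fin b → Ω → ℝ}
    (hβ : ∀ j, HasLaw (β j) (gaussianReal 0 σβsq) P)
    (he : ∀ i j, HasLaw (e i j) (gaussianReal 0 σsq) P)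
    (hindep : iIndepFun
      (Sum.elim β fun q : Fin a × Fin b => e q.1 q.2 : Fin b ⊕ Fin a × Fin b → Ω → ℝ) P)
    (hy : ∀ ω i j, y ω i j = θ i j + β j ω + e i j ω) :
    IsGaussianVector (fun ω => Function.uncurry (y ω)) (Function.uncurry θ)
      (blockCov a b σsq σβsq) P := by
  let X : Fin b ⊕ Fin a × Fin b → Ω → ℝ := Sum.elim β fun q ω => θ q.1 q.2 + e q.1 q.2 ω
  have hX (s) : HasLaw (X s) (gaussianReal (Sum.elim 0 (Function.uncurry θ) s)
      (Sum.elim (fun _ => σβsq) (fun _ => σsq) s)) P := by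
    obtain j | ⟨i, j⟩ := s
    · exact hβ j
    · have h := gaussianReal_const_add (he i j) (θ i j)
      rwa [zero_add] at h
  have hXind : iIndepFun X P := by
    convert hindep.comp (Sum.elim (fun _ => id) fun q => (θ q.1 q.2 + ·)) ?_ using 1
    · ext (_ | _) <;> rfl
    · rintro (_ | _)
      · exact measurable_id
      · exact measurable_const_add _
  convert (isGaussianVector_of_iIndepFun hX hXind).mulVec (randomDesign a b) using 1
  · ext ω ⟨i, j⟩
    simp only [Function.uncurry_apply_pair, hy, randomDesign_mulVec_apply, X, Sum.elim_inl,
      Sum.elim_inr]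
    ring
  · ext t
    simp only [randomDesign_mulVec_apply, Sum.elim_inl, Sum.elim_inr, Pi.zero_apply, zero_add]
  · rw [← randomDesign_mul_diagonal_mul_transpose]
    congr with (_ | _) <;> rfl

variable (σsq σβsq) in
/-- The variance of the coordinate `t` of `(U ⊗ₖ V) *ᵥ y`, for Helmert matrices `U` and `V`. -/
def coordVar [NeZero a] (t : Fin a × Fin b) : ℝ≥0 := if t.1 = 0 then σsq + a * σβsq else σsq

variable [NeZero a] [NeZero b]

omit [NeZero b] in
lemma kronecker_mul_blockCov_mul_transpose {U : Matrix (Fin a) (Fin a) ℝ}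
    {V : Matrix (Fin b) (Fin b) ℝ} (hU : IsHelmert U) (hV : V ∈ orthogonalGroup (Fin b) ℝ) :
    (U ⊗ₖ V) * blockCov a b σsq σβsq * (U ⊗ₖ V)ᵀ =
      diagonal fun t => (coordVar σsq σβsq t : ℝ) := by
  have hUU := (mem_orthogonalGroup_iff (Fin a) ℝ).1 hU.mem_orthogonalGroup
  have hVV := (mem_orthogonalGroup_iff (Fin b) ℝ).1 hV
  have hUJU : U * vecMulVec 1 1 * Uᵀ = diagonal (Pi.single 0 (a : ℝ)) := by
    rw [mul_vecMulVec, vecMulVec_mul, vecMul_transpose, hU.mulVec_one]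
    ext k k'
    simp only [vecMulVec_apply, diagonal_apply, Pi.single_apply]
    split_ifs <;> simp_all
  calc (U ⊗ₖ V) * blockCov a b σsq σβsq * (U ⊗ₖ V)ᵀ
      = (σβsq : ℝ) • ((U * vecMulVec 1 1 * Uᵀ) ⊗ₖ (V * Vᵀ)) +
          (σsq : ℝ) • ((U * Uᵀ) ⊗ₖ (V * Vᵀ)) := by
        simp only [blockCov, mul_add, add_mul, Matrix.mul_smul, Matrix.smul_mul,
          ← kroneckerMap_transpose, ← mul_kronecker_mul, Matrix.mul_one]
    _ = diagonal fun t => σβsq * (Pi.single 0 (a : ℝ) : Fin a → ℝ) t.1 + σsq := by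
        rw [hUJU, hUU, hVV, one_kronecker_one, ← diagonal_one, ← diagonal_one,
          diagonal_kronecker_diagonal, ← diagonal_smul, ← diagonal_smul, diagonal_add]
        simp
    _ = diagonal fun t => (coordVar σsq σβsq t : ℝ) := by
        congr with ⟨k, l⟩
        by_cases hk : k = 0
        · simp [coordVar, hk, mul_comm, add_comm]
        · simp [coordVar, hk]

lemma isGaussianVector_kronecker_mulVec {U : Matrix (Fin a) (Fin a) ℝ}
    {V : Matrix (Fin b) (Fin b) ℝ} (hU : IsHelmert U) (hV : IsHelmert V)
    (hy : IsGaussianVector (fun ω => Function.uncurry (y ω)) (Function.uncurry θ)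
      (blockCov a b σsq σβsq) P) :
    IsGaussianVector (fun ω => (U ⊗ₖ V) *ᵥ Function.uncurry (y ω)) ((U ⊗ₖ V) *ᵥ Function.uncurry θ)
      (diagonal fun t => (coordVar σsq σβsq t : ℝ)) P := by
  rw [← kronecker_mul_blockCov_mul_transpose hU hV.mem_orthogonalGroup]
  exact hy.mulVec _

section Laws

variable (hy : IsGaussianVector (fun ω => Function.uncurry (y ω)) (Function.uncurry θ)
  (blockCov a b σsq σβsq) P)

include hy

lemma iIndepFun_SSA_SSB_SSE :
    iIndepFun ![fun ω => SSA (y ω), fun ω => SSB (y ω), fun ω => SSE (y ω)] P := by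
  obtain ⟨U, hU⟩ := exists_isHelmert a
  obtain ⟨V, hV⟩ := exists_isHelmert b
  have hind := (isGaussianVector_kronecker_mulVec hU hV hy).iIndepFun_sum_sq (isDiag_diagonal _)
    pairwise_disjoint_stratum
  convert hind using 1
  ext c ω
  fin_cases c
  · exact (sum_stratum_zero_sq_eq_SSA hU hV _).symm
  · exact (sum_stratum_one_sq_eq_SSB hU hV _).symm
  · exact (sum_stratum_two_sq_eq_SSE hU hV _).symm

lemma hasLaw_SSA (hσ : 0 < σsq) :
    HasLaw (fun ω => SSA (y ω)) (scaled σsq (noncentralChiSquare (a - 1) (SSA θ / σsq))) P := by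
  obtain ⟨U, hU⟩ := exists_isHelmert a
  obtain ⟨V, hV⟩ := exists_isHelmert b
  have h := (isGaussianVector_kronecker_mulVec hU hV hy).hasLaw_sum_sq (isDiag_diagonal _) hσ
    (A := stratum a b 0) fun t ht => by
      obtain ⟨k, l⟩ := t
      simp_all [coordVar, stratum]
  simpa only [sum_stratum_zero_sq_eq_SSA hU hV, card_stratum_zero] using h

lemma hasLaw_SSB (hσ : 0 < σsq) :
    HasLaw (fun ω => SSB (y ω)) (scaled (σsq + a * σβsq)
      (noncentralChiSquare (b - 1) (SSB θ / (σsq + a * σβsq)))) P := by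
  obtain ⟨U, hU⟩ := exists_isHelmert a
  obtain ⟨V, hV⟩ := exists_isHelmert b
  have h := (isGaussianVector_kronecker_mulVec hU hV hy).hasLaw_sum_sq (isDiag_diagonal _)
    (v := σsq + a * σβsq) (by positivity)
    (A := stratum a b 1) fun t ht => by
      obtain ⟨k, l⟩ := t
      simp_all [coordVar, stratum]
  simpa [sum_stratum_one_sq_eq_SSB hU hV, card_stratum_one] using h

lemma hasLaw_SSE (hσ : 0 < σsq) :
    HasLaw (fun ω => SSE (y ω))
      (scaled σsq (noncentralChiSquare ((a - 1) * (b - 1)) (SSE θ / σsq))) P := by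
  obtain ⟨U, hU⟩ := exists_isHelmert a
  obtain ⟨V, hV⟩ := exists_isHelmert b
  have h := (isGaussianVector_kronecker_mulVec hU hV hy).hasLaw_sum_sq (isDiag_diagonal _) hσ
    (A := stratum a b 2) fun t ht => by
      obtain ⟨k, l⟩ := t
      simp_all [coordVar, stratum]
  simpa only [sum_stratum_two_sq_eq_SSE hU hV, card_stratum_two] using h

end Laws

section RowEffects

variable (μ : ℝ) (α : Fin a → ℝ)

omit [NeZero a] in
lemma rowMean_row_effects (i : Fin a) : rowMean (fun i (_ : Fin b) => μ + α i) i = μ + α i := by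
  rw [rowMean, Fin.sum_const, nsmul_eq_mul, mul_div_cancel_left₀ _ (NeZero.ne _)]

omit [NeZero b] in
lemma colMean_row_effects (j : Fin b) : colMean (fun i _ => μ + α i) j = μ + mean α := by
  rw [colMean, Finset.sum_add_distrib, Fin.sum_const, nsmul_eq_mul, add_div,
    mul_div_cancel_left₀ _ (NeZero.ne _), mean]

lemma grandMean_row_effects : grandMean (fun i (_ : Fin b) => μ + α i) = μ + mean α := by
  rw [← mean_rowMean, ← colMean_row_effects μ α (0 : Fin b)]
  simp only [rowMean_row_effects, mean, colMean]

lemma SSA_row_effects : SSA (fun i (_ : Fin b) => μ + α i) = gammaA b α := by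
  simp only [SSA, gammaA, rowMean_row_effects, grandMean_row_effects, add_sub_add_left_eq_sub]

lemma SSB_row_effects : SSB (fun i (_ : Fin b) => μ + α i) = 0 := by
  simp [SSB, colMean_row_effects, grandMean_row_effects]

lemma SSE_row_effects : SSE (fun i (_ : Fin b) => μ + α i) = 0 := by
  simp [SSE, rowMean_row_effects, colMean_row_effects, grandMean_row_effects]

end RowEffects

lemma FA_eq_div_div (z : Fin a → Fin b → ℝ) :
    FA z = (SSA z / (a - 1 : ℕ)) / (SSE z / ((a - 1) * (b - 1) : ℕ)) := by
  rw [Nat.cast_mul, Nat.cast_pred (Nat.pos_of_neZero a), Nat.cast_pred (Nat.pos_of_neZero b)]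
  rfl

lemma FB_eq_div_div (z : Fin a → Fin b → ℝ) :
    FB z = (SSB z / (b - 1 : ℕ)) / (SSE z / ((a - 1) * (b - 1) : ℕ)) := by
  rw [Nat.cast_mul, Nat.cast_pred (Nat.pos_of_neZero a), Nat.cast_pred (Nat.pos_of_neZero b)]
  rfl

end BlockDesign

end RCBD

theorem mainTheorem3 {Ω : Type*} [MeasurableSpace Ω] (P : Measure Ω) [IsProbabilityMeasure P]
    (a b : ℕ) (ha : 1 ≤ a) (hb : 1 ≤ b)
    -- overall mean, fixed effects of factor A, error variance `σ²` and block variance `σ²_β`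
    (μ : ℝ) (α : Fin a → ℝ) (σsq σβsq : ℝ≥0) (hσ : 0 < σsq)
    -- random block effects and errors, all mutually independent
    (β : Fin b → Ω → ℝ) (e : Fin a → Fin b → Ω → ℝ)
    (hβ : ∀ j, HasLaw (β j) (gaussianReal 0 σβsq) P)
    (he : ∀ i j, HasLaw (e i j) (gaussianReal 0 σsq) P)
    (hindep : iIndepFun
      (Sum.elim β fun q : Fin a × Fin b => e q.1 q.2 : Fin b ⊕ Fin a × Fin b → Ω → ℝ) P)
    -- the observations
    (y : Ω → Fin a → Fin b → ℝ)
    (hy : ∀ ω i j, y ω i j = μ + α i + β j ω + e i j ω) :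
    iIndepFun ![fun ω => RCBD.SSA (y ω), fun ω => RCBD.SSB (y ω), fun ω => RCBD.SSE (y ω)] P ∧
    HasLaw (fun ω => RCBD.SSA (y ω))
      (RCBD.scaled σsq (RCBD.noncentralChiSquare (a - 1) (RCBD.gammaA b α / σsq))) P ∧
    HasLaw (fun ω => RCBD.SSB (y ω))
      (RCBD.scaled (σsq + a * σβsq) (RCBD.chiSquare (b - 1))) P ∧
    HasLaw (fun ω => RCBD.SSE (y ω))
      (RCBD.scaled σsq (RCBD.chiSquare ((a - 1) * (b - 1)))) P ∧
    -- the F statistics make sense when all degrees of freedom are positive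
    (2 ≤ a → 2 ≤ b →
      HasLaw (fun ω => RCBD.FA (y ω))
        (RCBD.noncentralF (a - 1) ((a - 1) * (b - 1)) (RCBD.gammaA b α / σsq)) P ∧
      HasLaw (fun ω => RCBD.FB (y ω))
        (RCBD.scaled ((σsq + a * σβsq) / σsq)
          (RCBD.centralF (b - 1) ((a - 1) * (b - 1)))) P ∧
      -- null distributions
      (RCBD.gammaA b α = 0 →
        HasLaw (fun ω => RCBD.FA (y ω)) (RCBD.centralF (a - 1) ((a - 1) * (b - 1))) P) ∧
      (σβsq = 0 →
        HasLaw (fun ω => RCBD.FB (y ω)) (RCBD.centralF (b - 1) ((a - 1) * (b - 1))) P)) := by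
  have : NeZero a := ⟨by omega⟩
  have : NeZero b := ⟨by omega⟩
  have hY := RCBD.isGaussianVector_of_block_model hβ he hindep hy
  have hind := RCBD.iIndepFun_SSA_SSB_SSE hY
  have hA := RCBD.hasLaw_SSA hY hσ
  have hB := RCBD.hasLaw_SSB hY hσ
  have hE := RCBD.hasLaw_SSE hY hσ
  rw [RCBD.SSA_row_effects] at hA
  rw [RCBD.SSB_row_effects, zero_div] at hB
  rw [RCBD.SSE_row_effects, zero_div, RCBD.noncentralChiSquare_zero] at hE
  have hFA := RCBD.hasLaw_div_div_scaled_noncentralF hA hE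
    (hind.indepFun (i := 0) (j := 2) (by decide))
  have hFB := RCBD.hasLaw_div_div_scaled_noncentralF hB hE
    (hind.indepFun (i := 1) (j := 2) (by decide))
  rw [div_self (NNReal.coe_ne_zero.2 hσ.ne'), RCBD.scaled_one] at hFA
  rw [RCBD.noncentralF_zero] at hFB
  simp only [RCBD.FA_eq_div_div, RCBD.FB_eq_div_div]
  refine ⟨hind, hA, RCBD.noncentralChiSquare_zero _ ▸ hB, hE, fun _ _ => ⟨hFA, hFB, ?_, ?_⟩⟩
  · intro hγ
    rwa [hγ, zero_div, RCBD.noncentralF_zero] at hFA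
  · rintro rfl
    rwa [NNReal.coe_zero, mul_zero, add_zero, div_self (NNReal.coe_ne_zero.2 hσ.ne'),
      RCBD.scaled_one] at hFB
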